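/- All spaces are Tychonoff. A subset $C$ of a space $X$ is regularly closed if $C=\overline{\operatorname{Int} C}$. A quasi $\kappa$-metric on $X$ is a function $\rho$ assigning a real number $\rho(x,C)\ge 0$ to each point $x\in X$ and each regularly closed set $C\subset X$, such that: (1) for every regularly closed $C$ there is a dense open subset $V$ of $X\setminus C$ such that, for all $x\in X$, $\rho(x,C)>0$ iff $x\in V$; (2) if $C\subset C'$ are regularly closed, then $\rho(x,C')\le\rho(x,C)$ for every $x\in X$; (3) for every regularly closed $C$ the function $x\mapsto\rho(x,C)$ is continuous; (4) $\rho\bigl(x,\overline{\bigcup_\alpha C_\alpha}\bigr)=\inf_\alpha\rho(x,C_\alpha)$ for every $x\in X$ and every non-empty increasing transfinite (i.e. indexed by a well-ordered set) family $\{C_\alpha\}$ of regularly closed subsets of $X$. It is regular if moreover (5) $\rho(x,C)\le\rho(x,C')+\sup_{y\in C'}\rho(y,C)$ for all $x\in X$ and all regularly closed $C,C'\subset X$, where the supremum is taken in $[0,\infty]$ (so that it is $0$ for $C'=\varnothing$). The space $X$ is called (regularly) quasi $\kappa$-metrizable if it admits a (regular) quasi $\kappa$-metric, and pseudocompact if every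 continuous function $X\to\mathbb R$ is bounded. **Theorem.** Let $X$ be a pseudocompact Tychonoff space and let $\beta X$ be its Čech–Stone compactification. If $X$ is quasi $\kappa$-metrizable, then $\beta X$ is quasi $\kappa$-metrizable. If $X$ is regularly quasi $\kappa$-metrizable, then $\beta X$ is regularly quasi $\kappa$-metrizable. -/

import Mathlib

open scoped NNReal ENNReal

universe u

/-- A set `C` is regularly closed if it is the closure of its interior. -/
def IsRegularlyClosed {X : Type u} [TopologicalSpace X] (C : Set X) : Prop :=
  closure (interior C) = C

/-- A quasi `κ`-metric on `X`: a non-negative real function `ρ x C` of a point `x` and a regularly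
closed set `C`. Only the values at regularly closed sets matter. -/
structure IsQuasiKappaMetric {X : Type u} [TopologicalSpace X] (ρ : X → Set X → ℝ≥0) : Prop where
  /-- The positivity set of `ρ · C` is a dense open subset of `X \ C`. -/
  pos_iff : ∀ C : Set X, IsRegularlyClosed C →
    ∃ V : Set X, IsOpen V ∧ V ⊆ Cᶜ ∧ Cᶜ ⊆ closure V ∧ ∀ x : X, 0 < ρ x C ↔ x ∈ V
  /-- `ρ` is antitone in the regularly closed set. -/
  anti : ∀ C C' : Set X, IsRegularlyClosed C → IsRegularlyClosed C' → C ⊆ C' →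
    ∀ x : X, ρ x C' ≤ ρ x C
  /-- `ρ` is continuous in the point. -/
  cont : ∀ C : Set X, IsRegularlyClosed C → Continuous fun x : X => ρ x C
  /-- Increasing transfinite families: non-empty families indexed by a well-ordered set. Every
  chain of subsets of `X` which is well-ordered by inclusion is indexed by a type in the universe
  of `X`, so larger index types would add nothing. -/
  iInf_eq : ∀ (ι : Type u) [LinearOrder ι] [WellFoundedLT ι] [Nonempty ι] (C : ι → Set X),
    (∀ i, IsRegularlyClosed (C i)) → Monotone C →
    ∀ x : X, ρ x (closure (⋃ i, C i)) = ⨅ i, ρ x (C i)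

/-- A regular quasi `κ`-metric. The supremum is taken in `[0, ∞]`, where it always exists
(it is `0` for empty `C'`). -/
structure IsRegularQuasiKappaMetric {X : Type u} [TopologicalSpace X] (ρ : X → Set X → ℝ≥0) : Prop
    extends IsQuasiKappaMetric ρ where
  le_add_iSup : ∀ C C' : Set X, IsRegularlyClosed C → IsRegularlyClosed C' → ∀ x : X,
    (ρ x C : ℝ≥0∞) ≤ (ρ x C' : ℝ≥0∞) + ⨆ y ∈ C', (ρ y C : ℝ≥0∞)

/-- `X` admits a quasi `κ`-metric. -/
def QuasiKappaMetrizable (X : Type u) [TopologicalSpace X] : Prop :=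
  ∃ ρ : X → Set X → ℝ≥0, IsQuasiKappaMetric ρ

/-- `X` admits a regular quasi `κ`-metric. -/
def RegularlyQuasiKappaMetrizable (X : Type u) [TopologicalSpace X] : Prop :=
  ∃ ρ : X → Set X → ℝ≥0, IsRegularQuasiKappaMetric ρ

/-- Every continuous real-valued function on `X` is bounded. (For Tychonoff spaces.) -/
def IsPseudocompact (X : Type u) [TopologicalSpace X] : Prop :=
  ∀ f : X → ℝ, Continuous f → ∃ M : ℝ, ∀ x : X, |f x| ≤ M

/-!
Pseudocompactness makes each function `ρ (·, F ∩ X)` bounded, so it extends continuously to `βX`;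
the extensions are the new quasi `κ`-metric. Closed conditions pass from the dense subspace `X` to
`βX`, and the only axiom that is not one is the infimum formula for increasing families. It passes
to `βX` because on `X` the infimum is approached uniformly. For sequences this is Dini's theorem,
valid on pseudocompact spaces; a longer family without an index past which `ρ` drops by at most `ε`
would contain a sequence dropping by more than `ε` at each step.
-/

open Function Set Topology

section Pseudocompact

variable {X : Type*} [TopologicalSpace X]

theorem IsPseudocompact.finite_ne_zero_of_locallyFinite (hX : IsPseudocompact X) {ι : Type*}
    {f : ι → X → ℝ} (hf : ∀ i, Continuous (f i)) (hfin : LocallyFinite fun i => support (f i)) :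
    {i | f i ≠ 0}.Finite := by
  by_contra hinf
  let a : ℕ ↪ {i | f i ≠ 0} := Set.Infinite.natEmbedding _ hinf
  choose x hx using fun n => Function.ne_iff.mp (a n).2
  -- Normalised to take the value `n` at `x n`, the functions have an unbounded sum.
  let p : ℕ → X → ℝ := fun n z => n * |f (a n) z / f (a n) (x n)|
  have hp : ∀ n, Continuous (p n) := fun n => by
    have := hf (a n)
    fun_prop
  have hpfin : LocallyFinite fun n => support (p n) := by
    refine (hfin.comp_injective (Subtype.val_injective.comp a.injective)).subset fun n z hz => ?_
    contrapose! hz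
    simp only [comp_apply, notMem_support] at hz
    simp only [p, notMem_support, hz, zero_div, abs_zero, mul_zero]
  obtain ⟨M, hM⟩ := hX (fun z => ∑ᶠ n, p n z) (continuous_finsum hp hpfin)
  obtain ⟨n, hn⟩ := exists_nat_gt M
  have hle : p n (x n) ≤ ∑ᶠ k, p k (x n) :=
    single_le_finsum n (hpfin.point_finite (x n)) fun k => by positivity
  have hval : p n (x n) = n := by simp only [p, div_self (hx n), abs_one, mul_one]
  linarith [le_abs_self (∑ᶠ k, p k (x n)), hM (x n)]

/-- A one-sided form of **Dini's theorem**. -/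
theorem IsPseudocompact.exists_forall_le_of_antitone (hX : IsPseudocompact X)
    {f : ℕ → X → ℝ} {g : X → ℝ} (hf : ∀ n, Continuous (f n)) (hg : Continuous g)
    (hanti : Antitone f) (hlt : ∀ x, ∃ n, f n x < g x) : ∃ n, ∀ x, f n x ≤ g x := by
  let p : ℕ → X → ℝ := fun n x => max 0 (f n x - g x)
  have hp : ∀ n, Continuous (p n) := fun n => continuous_const.max ((hf n).sub hg)
  have hpfin : LocallyFinite fun n => support (p n) := by
    intro x
    obtain ⟨N, hN⟩ := hlt x
    refine ⟨{z | f N z < g z}, (isOpen_lt (hf N) hg).mem_nhds hN,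
      (finite_lt_nat N).subset ?_⟩
    rintro n ⟨z, hz, hzN : f N z < g z⟩
    by_contra hn
    exact hz (max_eq_left (sub_nonpos.mpr ((hanti (not_lt.mp hn) z).trans hzN.le)))
  obtain ⟨n, hn⟩ := (hX.finite_ne_zero_of_locallyFinite hp hpfin).exists_notMem
  have hzero : p n = 0 := not_not.mp hn
  exact ⟨n, fun x => sub_nonpos.mp (max_eq_left_iff.mp (congrFun hzero x))⟩

theorem IsPseudocompact.exists_stoneCech_extension (hX : IsPseudocompact X) {f : X → ℝ}
    (hf : Continuous f) :
    ∃ g : StoneCech X → ℝ, Continuous g ∧ ∀ x, g (stoneCechUnit x) = f x := by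
  obtain ⟨M, hM⟩ := hX f hf
  have hf' : Continuous fun x => (⟨f x, abs_le.mp (hM x)⟩ : Icc (-M) M) := hf.subtype_mk _
  exact ⟨fun y => (stoneCechExtend hf' y : Icc (-M) M),
    continuous_subtype_val.comp (continuous_stoneCechExtend hf'),
    fun x => congrArg Subtype.val (stoneCechExtend_stoneCechUnit hf' x)⟩

end Pseudocompact

section RegularlyClosed

variable {X Y : Type*} [TopologicalSpace Y] {e : X → Y}

theorem IsRegularlyClosed.isClosed {C : Set Y} (hC : IsRegularlyClosed C) : IsClosed C :=
  hC ▸ isClosed_closure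

theorem IsRegularlyClosed.closure_iUnion {ι : Sort*} {C : ι → Set Y}
    (hC : ∀ i, IsRegularlyClosed (C i)) : IsRegularlyClosed (closure (⋃ i, C i)) := by
  refine (closure_minimal interior_subset isClosed_closure).antisymm ?_
  refine closure_minimal (iUnion_subset fun i => ?_) isClosed_closure
  rw [← hC i]
  exact closure_mono (interior_mono ((subset_iUnion C i).trans subset_closure))

theorem closure_subset_closure_image_preimage (he : DenseRange e) {U : Set Y} (hU : IsOpen U) :
    closure U ⊆ closure (e '' (e ⁻¹' U)) := by
  rw [image_preimage_eq_inter_range]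
  exact closure_minimal (he.open_subset_closure_inter hU) isClosed_closure

theorem IsRegularlyClosed.closure_image_preimage {F : Set Y} (hF : IsRegularlyClosed F)
    (he : DenseRange e) : closure (e '' (e ⁻¹' F)) = F := by
  refine (closure_minimal (image_preimage_subset _ _) hF.isClosed).antisymm ?_
  calc F = closure (interior F) := hF.symm
    _ ⊆ closure (e '' (e ⁻¹' interior F)) :=
      closure_subset_closure_image_preimage he isOpen_interior
    _ ⊆ closure (e '' (e ⁻¹' F)) := closure_mono (image_mono (preimage_mono interior_subset))

variable [TopologicalSpace X]

theorem IsRegularlyClosed.preimage {F : Set Y} (hF : IsRegularlyClosed F)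
    (he : IsDenseInducing e) : IsRegularlyClosed (e ⁻¹' F) := by
  refine (closure_minimal interior_subset (hF.isClosed.preimage he.continuous)).antisymm ?_
  calc e ⁻¹' F = e ⁻¹' closure (interior F) := by rw [hF]
    _ ⊆ e ⁻¹' closure (e '' (e ⁻¹' interior F)) :=
      preimage_mono (closure_subset_closure_image_preimage he.dense isOpen_interior)
    _ = closure (e ⁻¹' interior F) := (he.isInducing.closure_eq_preimage_closure_image _).symm
    _ ⊆ closure (interior (e ⁻¹' F)) :=
      closure_mono (preimage_interior_subset_interior_preimage he.continuous)

theorem IsRegularlyClosed.preimage_closure_iUnion {ι : Sort*} {F : ι → Set Y}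
    (hF : ∀ i, IsRegularlyClosed (F i)) (he : IsDenseInducing e) :
    e ⁻¹' closure (⋃ i, F i) = closure (⋃ i, e ⁻¹' F i) := by
  have hclosure : closure (⋃ i, F i) = closure (⋃ i, e '' (e ⁻¹' F i)) := by
    refine (closure_minimal (iUnion_subset fun i => ?_) isClosed_closure).antisymm
      (closure_mono (iUnion_mono fun i => image_preimage_subset _ _))
    rw [← (hF i).closure_image_preimage he.dense]
    exact closure_mono (subset_iUnion (fun i => e '' (e ⁻¹' F i)) i)
  rw [he.isInducing.closure_eq_preimage_closure_image, image_iUnion, hclosure]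

end RegularlyClosed

namespace IsQuasiKappaMetric

variable {X : Type u} [TopologicalSpace X] {ρ : X → Set X → ℝ≥0}

theorem eq_zero_of_mem (hρ : IsQuasiKappaMetric ρ) {C : Set X} (hC : IsRegularlyClosed C) {x : X}
    (hx : x ∈ C) : ρ x C = 0 := by
  obtain ⟨V, -, hVC, -, hpos⟩ := hρ.pos_iff C hC
  exact nonpos_iff_eq_zero.mp (not_lt.mp fun h => hVC ((hpos x).mp h) hx)

theorem compl_subset_closure_pos (hρ : IsQuasiKappaMetric ρ) {C : Set X}
    (hC : IsRegularlyClosed C) : Cᶜ ⊆ closure {x | 0 < ρ x C} := by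
  obtain ⟨V, -, -, hdense, hpos⟩ := hρ.pos_iff C hC
  exact hdense.trans (closure_mono fun x => (hpos x).mpr)

theorem iInf_eq_nat (hρ : IsQuasiKappaMetric ρ) {C : ℕ → Set X}
    (hC : ∀ n, IsRegularlyClosed (C n)) (hmono : Monotone C) (x : X) :
    ρ x (closure (⋃ n, C n)) = ⨅ n, ρ x (C n) := by
  have h := hρ.iInf_eq (ULift.{u} ℕ) (fun n => C n.down) (fun n => hC n.down)
    (fun _ _ hmn => hmono hmn) x
  rwa [ULift.down_surjective.iUnion_comp C,
    ULift.down_surjective.iInf_comp fun n => ρ x (C n)] at h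

theorem exists_nat_forall_le_add (hρ : IsQuasiKappaMetric ρ) (hX : IsPseudocompact X)
    {C : ℕ → Set X} (hC : ∀ n, IsRegularlyClosed (C n)) (hmono : Monotone C) {ε : ℝ≥0}
    (hε : 0 < ε) : ∃ n, ∀ x, ρ x (C n) ≤ ρ x (closure (⋃ k, C k)) + ε := by
  have hlt : ∀ x, ∃ n, ρ x (C n) < ρ x (closure (⋃ k, C k)) + ε := fun x =>
    exists_lt_of_ciInf_lt (by
      rw [hρ.iInf_eq_nat hC hmono x]
      exact lt_add_of_pos_right _ hε)
  have hU := IsRegularlyClosed.closure_iUnion hC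
  exact_mod_cast hX.exists_forall_le_of_antitone (f := fun n x => (ρ x (C n) : ℝ))
    (g := fun x => ((ρ x (closure (⋃ k, C k)) + ε : ℝ≥0) : ℝ))
    (fun n => NNReal.continuous_coe.comp (hρ.cont _ (hC n)))
    (NNReal.continuous_coe.comp ((hρ.cont _ hU).add continuous_const))
    (fun m n hmn x => NNReal.coe_le_coe.mpr (hρ.anti _ _ (hC m) (hC n) (hmono hmn) x))
    (by exact_mod_cast hlt)

theorem exists_forall_ge_le_add (hρ : IsQuasiKappaMetric ρ) (hX : IsPseudocompact X)
    {ι : Type*} [Preorder ι] [Nonempty ι] {C : ι → Set X} (hC : ∀ i, IsRegularlyClosed (C i))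
    (hmono : Monotone C) {ε : ℝ≥0} (hε : 0 < ε) :
    ∃ i, ∀ j, i ≤ j → ∀ x, ρ x (C i) ≤ ρ x (C j) + ε := by
  by_contra! hdrop
  choose next hnext x hx using hdrop
  let a : ℕ → ι := fun n => next^[n] (Classical.arbitrary ι)
  have ha : ∀ n, a (n + 1) = next (a n) := fun n => iterate_succ_apply' next n _
  have hamono : Monotone a := monotone_nat_of_le_succ fun n => (ha n).symm ▸ hnext (a n)
  obtain ⟨n, hn⟩ := hρ.exists_nat_forall_le_add hX (fun n => hC (a n)) (hmono.comp hamono) hε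
  have hsub : C (next (a n)) ⊆ closure (⋃ k, C (a k)) := by
    rw [← ha n]
    exact (subset_iUnion (fun k => C (a k)) (n + 1)).trans subset_closure
  have hle := hρ.anti _ _ (hC _) (IsRegularlyClosed.closure_iUnion fun k => hC (a k)) hsub (x (a n))
  exact (hx (a n)).not_ge ((hn _).trans (by gcongr))

theorem exists_forall_le_add (hρ : IsQuasiKappaMetric ρ) (hX : IsPseudocompact X)
    {ι : Type u} [LinearOrder ι] [WellFoundedLT ι] [Nonempty ι] {C : ι → Set X}
    (hC : ∀ i, IsRegularlyClosed (C i)) (hmono : Monotone C) {ε : ℝ≥0} (hε : 0 < ε) :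
    ∃ i, ∀ x, ρ x (C i) ≤ ρ x (closure (⋃ j, C j)) + ε := by
  obtain ⟨i, hi⟩ := hρ.exists_forall_ge_le_add hX hC hmono hε
  refine ⟨i, fun x => ?_⟩
  rw [hρ.iInf_eq ι C hC hmono x, ← tsub_le_iff_right]
  refine le_ciInf fun j => tsub_le_iff_right.mpr ?_
  rcases le_total i j with hij | hji
  · exact hi j hij x
  · exact (hρ.anti _ _ (hC j) (hC i) (hmono hji) x).trans le_self_add

end IsQuasiKappaMetric

/-- `σ` is a continuous extension of `ρ` along `e`: for each regularly closed `F` in `Y`, the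
function `σ · F` is continuous and extends `ρ · (e ⁻¹' F)`. For an inclusion `X ⊆ Y` this reads
`σ (x, F) = ρ (x, F ∩ X)`. As for quasi `κ`-metrics, values at other sets are ignored. -/
structure IsContinuousExtension {X : Type*} {Y : Type*} [TopologicalSpace Y] (e : X → Y)
    (ρ : X → Set X → ℝ≥0) (σ : Y → Set Y → ℝ≥0) : Prop where
  continuous : ∀ {F : Set Y}, IsRegularlyClosed F → Continuous fun y => σ y F
  apply_eq : ∀ {F : Set Y}, IsRegularlyClosed F → ∀ x, σ (e x) F = ρ x (e ⁻¹' F)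

theorem exists_isContinuousExtension {X Y : Type*} [TopologicalSpace X] [TopologicalSpace Y]
    {e : X → Y} (he : IsDenseInducing e)
    (hext : ∀ f : X → ℝ, Continuous f → ∃ g : Y → ℝ, Continuous g ∧ ∀ x, g (e x) = f x)
    {ρ : X → Set X → ℝ≥0} (hρ : ∀ C, IsRegularlyClosed C → Continuous fun x => ρ x C) :
    ∃ σ, IsContinuousExtension e ρ σ := by
  choose! extend hcont hextend using hext
  have hρ' : ∀ {F : Set Y}, IsRegularlyClosed F → Continuous fun x => (ρ x (e ⁻¹' F) : ℝ) :=
    fun hF => NNReal.continuous_coe.comp (hρ _ (hF.preimage he))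
  refine ⟨fun y F => (extend (fun x => ρ x (e ⁻¹' F)) y).toNNReal,
    fun hF => continuous_real_toNNReal.comp (hcont _ (hρ' hF)), fun hF x => ?_⟩
  rw [hextend _ (hρ' hF), Real.toNNReal_coe]

namespace IsContinuousExtension

variable {X Y : Type u} [TopologicalSpace Y] {e : X → Y} {ρ : X → Set X → ℝ≥0}
  {σ : Y → Set Y → ℝ≥0}

theorem coe_le_coe_add (hσ : IsContinuousExtension e ρ σ) (he : DenseRange e) {F G : Set Y}
    (hF : IsRegularlyClosed F) (hG : IsRegularlyClosed G) {c : ℝ≥0∞}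
    (h : ∀ x, (ρ x (e ⁻¹' F) : ℝ≥0∞) ≤ ρ x (e ⁻¹' G) + c) (y : Y) :
    (σ y F : ℝ≥0∞) ≤ σ y G + c := by
  refine he.induction_on y (isClosed_le (ENNReal.continuous_coe.comp (hσ.continuous hF))
    ((ENNReal.continuous_coe.comp (hσ.continuous hG)).add continuous_const)) fun x => ?_
  simpa only [hσ.apply_eq hF, hσ.apply_eq hG] using h x

variable [TopologicalSpace X]

theorem anti (hσ : IsContinuousExtension e ρ σ) (he : IsDenseInducing e)
    (hρ : IsQuasiKappaMetric ρ) {F G : Set Y} (hF : IsRegularlyClosed F)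
    (hG : IsRegularlyClosed G) (hFG : F ⊆ G) (y : Y) : σ y G ≤ σ y F := by
  have h := hσ.coe_le_coe_add he.dense hG hF (c := 0) (fun x => by
    rw [add_zero]
    exact_mod_cast hρ.anti _ _ (hF.preimage he) (hG.preimage he) (preimage_mono hFG) x) y
  rw [add_zero] at h
  exact_mod_cast h

theorem eq_zero_of_mem (hσ : IsContinuousExtension e ρ σ) (he : IsDenseInducing e)
    (hρ : IsQuasiKappaMetric ρ) {F : Set Y} (hF : IsRegularlyClosed F) {y : Y} (hy : y ∈ F) :
    σ y F = 0 := by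
  rw [← hF.closure_image_preimage he.dense] at hy
  refine closure_minimal (t := {y | σ y F = 0}) ?_
    (isClosed_eq (hσ.continuous hF) continuous_const) hy
  rintro _ ⟨x, hx, rfl⟩
  exact (hσ.apply_eq hF x).trans (hρ.eq_zero_of_mem (hF.preimage he) hx)

theorem compl_subset_closure_pos (hσ : IsContinuousExtension e ρ σ) (he : IsDenseInducing e)
    (hρ : IsQuasiKappaMetric ρ) {F : Set Y} (hF : IsRegularlyClosed F) :
    Fᶜ ⊆ closure {y | 0 < σ y F} :=
  calc Fᶜ ⊆ closure (e '' (e ⁻¹' Fᶜ)) := subset_closure.trans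
        (closure_subset_closure_image_preimage he.dense hF.isClosed.isOpen_compl)
    _ ⊆ closure (e '' closure {x | 0 < ρ x (e ⁻¹' F)}) :=
      closure_mono (image_mono (hρ.compl_subset_closure_pos (hF.preimage he)))
    _ ⊆ closure (e '' {x | 0 < ρ x (e ⁻¹' F)}) :=
      closure_minimal (image_closure_subset_closure_image he.continuous) isClosed_closure
    _ ⊆ closure {y | 0 < σ y F} := closure_mono (image_subset_iff.mpr fun x hx =>
      hx.trans_eq (hσ.apply_eq hF x).symm)

theorem iInf_eq (hσ : IsContinuousExtension e ρ σ) (he : IsDenseInducing e)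
    (hρ : IsQuasiKappaMetric ρ) (hX : IsPseudocompact X) {ι : Type u} [LinearOrder ι]
    [WellFoundedLT ι] [Nonempty ι] {F : ι → Set Y} (hF : ∀ i, IsRegularlyClosed (F i))
    (hmono : Monotone F) (y : Y) : σ y (closure (⋃ i, F i)) = ⨅ i, σ y (F i) := by
  have hU := IsRegularlyClosed.closure_iUnion hF
  refine le_antisymm (le_ciInf fun i => hσ.anti he hρ (hF i) hU
    ((subset_iUnion F i).trans subset_closure) y) (le_of_forall_pos_le_add fun ε hε => ?_)
  obtain ⟨i, hi⟩ := hρ.exists_forall_le_add hX (fun i => (hF i).preimage he)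
    (fun _ _ hij => preimage_mono (hmono hij)) hε
  rw [← IsRegularlyClosed.preimage_closure_iUnion hF he] at hi
  have hle : σ y (F i) ≤ σ y (closure (⋃ j, F j)) + ε := by
    exact_mod_cast hσ.coe_le_coe_add he.dense (hF i) hU (c := ε) (by exact_mod_cast hi) y
  exact (ciInf_le (OrderBot.bddBelow _) i).trans hle

theorem isQuasiKappaMetric (hσ : IsContinuousExtension e ρ σ) (he : IsDenseInducing e)
    (hρ : IsQuasiKappaMetric ρ) (hX : IsPseudocompact X) : IsQuasiKappaMetric σ where
  pos_iff F hF := ⟨{y | 0 < σ y F}, isOpen_lt continuous_const (hσ.continuous hF),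
    fun _ hy hyF => hy.ne' (hσ.eq_zero_of_mem he hρ hF hyF),
    hσ.compl_subset_closure_pos he hρ hF, fun _ => Iff.rfl⟩
  anti _ _ hF hG := hσ.anti he hρ hF hG
  cont _ hF := hσ.continuous hF
  iInf_eq _ _ _ _ _ hF hmono := hσ.iInf_eq he hρ hX hF hmono

theorem isRegularQuasiKappaMetric (hσ : IsContinuousExtension e ρ σ) (he : IsDenseInducing e)
    (hρ : IsRegularQuasiKappaMetric ρ) (hX : IsPseudocompact X) :
    IsRegularQuasiKappaMetric σ where
  toIsQuasiKappaMetric := hσ.isQuasiKappaMetric he hρ.toIsQuasiKappaMetric hX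
  le_add_iSup F G hF hG := hσ.coe_le_coe_add he.dense hF hG fun x => by
    have hsup : ⨆ z ∈ e ⁻¹' G, (ρ z (e ⁻¹' F) : ℝ≥0∞) ≤ ⨆ y ∈ G, (σ y F : ℝ≥0∞) :=
      iSup₂_le fun z hz => by
        rw [← hσ.apply_eq hF]
        exact le_iSup₂ (f := fun y (_ : y ∈ G) => (σ y F : ℝ≥0∞)) (e z) hz
    exact (hρ.le_add_iSup _ _ (hF.preimage he) (hG.preimage he) x).trans (by gcongr)

end IsContinuousExtension

theorem theorem3p3_general {X Y : Type u} [TopologicalSpace X] [TopologicalSpace Y]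
    (hX : IsPseudocompact X) {e : X → Y} (he : IsDenseInducing e)
    (hext : ∀ f : X → ℝ, Continuous f → ∃ g : Y → ℝ, Continuous g ∧ ∀ x, g (e x) = f x) :
    (QuasiKappaMetrizable X → QuasiKappaMetrizable Y) ∧
    (RegularlyQuasiKappaMetrizable X → RegularlyQuasiKappaMetrizable Y) := by
  constructor
  · rintro ⟨ρ, hρ⟩
    obtain ⟨σ, hσ⟩ := exists_isContinuousExtension he hext hρ.cont
    exact ⟨σ, hσ.isQuasiKappaMetric he hρ hX⟩
  · rintro ⟨ρ, hρ⟩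
    obtain ⟨σ, hσ⟩ := exists_isContinuousExtension he hext hρ.cont
    exact ⟨σ, hσ.isRegularQuasiKappaMetric he hρ hX⟩

theorem theorem3p3 (X : Type u) [TopologicalSpace X] [T35Space X] (hX : IsPseudocompact X) :
    (QuasiKappaMetrizable X → QuasiKappaMetrizable (StoneCech X)) ∧
    (RegularlyQuasiKappaMetrizable X → RegularlyQuasiKappaMetrizable (StoneCech X)) := by
  exact theorem3p3_general hX isDenseEmbedding_stoneCechUnit.isDenseInducing
    fun _ => hX.exists_stoneCech_extension
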